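/- Let $w\in F(X_1,\ldots,X_d)$ be a word in the free group on $X_1,\dots,X_d$, with reduced form $w=x_1^{\epsilon_1}\cdots x_\ell^{\epsilon_\ell}$, where $x_t\in\{X_1,\ldots,X_d\}$ and $\epsilon_t\in\{\pm1\}$. Definitions. For $1\le t\le \ell$ let $I_t(w):=x_1^{\epsilon_1}\cdots x_{t-1}^{\epsilon_{t-1}}$ if $\epsilon_t=1$ and $I_t(w):=x_1^{\epsilon_1}\cdots x_t^{\epsilon_t}$ if $\epsilon_t=-1$, and for $1\le i<j\le \ell$ let $\Delta_{i,j}(w):=I_i(w)^{-1}I_j(w)$. A variation of $w$ is a word $w'=y_1^{\epsilon_1}\cdots y_\ell^{\epsilon_\ell}$ obtained from $w$ by adding to the variable $x_t$ at each position $t$ some second index, so that $y_t=(x_t,f(t))$ with $f(t)\in\mathbb N$ arbitrary; it is an $(i,j)$-split variation if $x_i=x_j$ and $y_i\neq y_j$. A word $u$ in the variables $Y_1,\dots,Y_m$ is a coset identity over a nonabelian finite simple group $S$ if there are $\alpha_1,\ldots,\alpha_m\in\mathrm{Aut}(S)$ such that the word map of $u$ on $\mathrm{Aut}(S)$ is constant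 on $\prod_{k=1}^m S\alpha_k$ (with $S$ identified with $\mathrm{Inn}(S)$); $u$ is weakly multiplicity-bounding (WMB) if it is not a coset identity over any nonabelian finite simple group. A group $G$ satisfies the identity $u\equiv1$ if $u(g_1,\ldots,g_m)=1$ for all $g_1,\ldots,g_m\in G$. A finite group $H$ is semisimple if it has no nontrivial solvable normal subgroup; then conjugation embeds $H$ into $\mathrm{Aut}(\mathrm{Soc}(H))$, where $\mathrm{Soc}(H)\cong S_1^{n_1}\times\cdots\times S_r^{n_r}$ with $S_1,\ldots,S_r$ pairwise nonisomorphic nonabelian finite simple groups, and the permutation part of $H$ is $P(H):=H/(H\cap(\mathrm{Aut}(S_1)^{n_1}\times\cdots\times\mathrm{Aut}(S_r)^{n_r}))$, i.e. the quotient of $H$ by the subgroup of all elements that normalize each simple direct factor (equivalently, each minimal normal subgroup) of $\mathrm{Soc}(H)$. Theorem. Let $1\le i<j\le\ell$ with $x_i=x_j$, and assume that all $(i,j)$-split variations of $w$ are WMB. If a finite semisimple group $H$ satisfies the identity $w\equiv1$, then $P(H)$ satisfies the identity $\Delta_{i,j}(w)\equiv1$. In particular, there is a nontrivial word $v\in F(X_1,\ldots,X_d)$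 of length strictly smaller than $\ell$ such that $P(H)$ satisfies the identity $v\equiv1$. -/

import Mathlib

namespace SegmentIdentity

/-! ### Words

A word in `d` variables is an element `w` of `FreeGroup (Fin d)`. Its reduced form
`x_1^{ε_1} ⋯ x_ℓ^{ε_ℓ}` is the list `w.toWord`, whose positions are numbered from `0` here,
and whose entries are pairs (variable, sign), the sign `true` standing for the exponent `1` and
`false` for `-1`. Its length `ℓ` is `w.toWord.length`. -/

/-- The variable at position `t` of the reduced word `w`. -/
def letterVar {d : ℕ} (w : FreeGroup (Fin d)) (t : Fin w.toWord.length) : Fin d :=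
  (w.toWord.get t).1

/-- The sign of the exponent at position `t` of the reduced word `w`. -/
def letterSign {d : ℕ} (w : FreeGroup (Fin d)) (t : Fin w.toWord.length) : Bool :=
  (w.toWord.get t).2

/-- The initial segment of `w` attached to position `t`: everything strictly before position `t`
if the exponent there is `1`, everything up to and including position `t` if it is `-1`. -/
def initSegment {d : ℕ} (w : FreeGroup (Fin d)) (t : Fin w.toWord.length) : FreeGroup (Fin d) :=
  FreeGroup.mk (w.toWord.take (if letterSign w t then (t : ℕ) else (t : ℕ) + 1))

/-- The segment word `Δ_{i,j}(w) = I_i(w)⁻¹ I_j(w)`. -/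
def segment {d : ℕ} (w : FreeGroup (Fin d)) (i j : Fin w.toWord.length) : FreeGroup (Fin d) :=
  (initSegment w i)⁻¹ * initSegment w j

/-- The word obtained from `w` by adding to the variable at each position `t` the second
index `f t`. -/
def variation {d : ℕ} (w : FreeGroup (Fin d)) (f : Fin w.toWord.length → ℕ) :
    FreeGroup (Fin d × ℕ) :=
  FreeGroup.mk (List.ofFn fun t => ((letterVar w t, f t), letterSign w t))

/-- `w'` is an `(i,j)`-split variation of `w`: a variation of `w` in which the variables at the
positions `i` and `j` differ, although they agree in `w`. -/
def IsSplitVariation {d : ℕ} (w : FreeGroup (Fin d)) (i j : Fin w.toWord.length)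
    (w' : FreeGroup (Fin d × ℕ)) : Prop :=
  ∃ f : Fin w.toWord.length → ℕ, w' = variation w f ∧
    letterVar w i = letterVar w j ∧ (letterVar w i, f i) ≠ (letterVar w j, f j)

/-- The group `G` satisfies the identity `w ≡ 1`. -/
def SatisfiesIdentity {σ : Type*} (G : Type*) [Group G] (w : FreeGroup σ) : Prop :=
  ∀ g : σ → G, FreeGroup.lift g w = 1

/-- `w` is a coset identity over `S`: for some automorphisms `α_x` of `S`, the word map of `w` on
`Aut(S)` is constant on the product of the cosets `S α_x`, where `S` is identified with the group
of its inner automorphisms. -/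
def IsCosetIdentity {σ : Type*} (w : FreeGroup σ) (S : Type*) [Group S] : Prop :=
  ∃ α : σ → MulAut S, ∃ β : MulAut S,
    ∀ s : σ → S, FreeGroup.lift (fun x => MulAut.conj (s x) * α x) w = β

/-- `w` is weakly multiplicity-bounding: it is not a coset identity over any nonabelian finite
simple group. -/
def IsWMB {σ : Type*} (w : FreeGroup σ) : Prop :=
  ∀ (S : Type) [Group S] [Finite S] [IsSimpleGroup S],
    (∃ a b : S, a * b ≠ b * a) → ¬ IsCosetIdentity w S

/-! ### Semisimple groups and the permutation part -/

/-- A group without nontrivial solvable normal subgroups. -/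
def IsSemisimple (H : Type*) [Group H] : Prop :=
  ∀ N : Subgroup H, N.Normal → Group.IsSolvable N → N = ⊥

/-- `N` is a minimal normal subgroup of `G`. -/
def IsMinimalNormal {G : Type*} [Group G] (N : Subgroup G) : Prop :=
  Minimal (fun K : Subgroup G => K.Normal ∧ K ≠ ⊥) N

/-- The socle: the subgroup generated by all minimal normal subgroups. -/
def socle (G : Type*) [Group G] : Subgroup G :=
  sSup {N : Subgroup G | IsMinimalNormal N}

instance socle_normal (G : Type*) [Group G] : (socle G).Normal :=
  Subgroup.sSup_normal {N : Subgroup G | IsMinimalNormal N}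
    fun N (hN : IsMinimalNormal N) => hN.prop.1

theorem IsMinimalNormal.map_mulEquiv {G : Type*} [Group G] {N : Subgroup G}
    (hN : IsMinimalNormal N) (φ : MulAut G) : IsMinimalNormal (N.map φ.toMonoidHom) := by
  refine ⟨⟨hN.prop.1.map _ φ.surjective, fun h => hN.prop.2 ?_⟩, ?_⟩
  · exact (Subgroup.map_eq_bot_iff_of_injective _ φ.injective).1 h
  · rintro K ⟨hK, hK0⟩ hle
    have h1 : K.comap φ.toMonoidHom ≤ N := by
      have := Subgroup.comap_mono (f := φ.toMonoidHom) hle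
      rwa [Subgroup.comap_map_eq_self_of_injective φ.injective] at this
    have h2 : K.comap φ.toMonoidHom ≠ ⊥ := by
      intro h
      apply hK0
      rw [← Subgroup.map_comap_eq_self_of_surjective (f := φ.toMonoidHom) φ.surjective K, h,
        Subgroup.map_bot]
    have h3 := hN.le_of_le ⟨hK.comap _, h2⟩ h1
    exact Subgroup.map_le_iff_le_comap.2 h3

/-- The automorphisms of `N` that map each minimal normal subgroup of `N` onto itself. When
`N = S_1^{n_1} × ⋯ × S_r^{n_r}` with pairwise nonisomorphic nonabelian simple groups `S_k`, the
minimal normal subgroups of `N` are the `n_1 + ⋯ + n_r` simple direct factors, so that this is the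
base group `Aut(S_1)^{n_1} × ⋯ × Aut(S_r)^{n_r}` of
`Aut(N) = (Aut(S_1) ≀ Sym(n_1)) × ⋯ × (Aut(S_r) ≀ Sym(n_r))`. -/
def baseGroup (N : Type*) [Group N] : Subgroup (MulAut N) where
  carrier := {φ | ∀ T : Subgroup N, IsMinimalNormal T → T.map φ.toMonoidHom = T}
  one_mem' := fun T _ => Subgroup.map_id T
  mul_mem' := by
    intro φ ψ hφ hψ T hT
    have : T.map (φ * ψ).toMonoidHom = (T.map ψ.toMonoidHom).map φ.toMonoidHom := by
      rw [Subgroup.map_map]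
      rfl
    rw [this, hψ T hT, hφ T hT]
  inv_mem' := by
    intro φ hφ T hT
    have h : (T.map φ.toMonoidHom).map (φ⁻¹).toMonoidHom = T := by
      rw [Subgroup.map_map]
      convert Subgroup.map_id T
      ext x
      exact φ.symm_apply_apply x
    rwa [hφ T hT] at h

instance baseGroup_normal (N : Type*) [Group N] : (baseGroup N).Normal where
  conj_mem := by
    intro φ hφ ψ T hT
    have h1 := hφ _ (hT.map_mulEquiv ψ⁻¹)
    have h2 : T.map (ψ * φ * ψ⁻¹).toMonoidHom =
        ((T.map (ψ⁻¹).toMonoidHom).map φ.toMonoidHom).map ψ.toMonoidHom := by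
      rw [Subgroup.map_map, Subgroup.map_map]
      rfl
    rw [h2, h1, Subgroup.map_map]
    convert Subgroup.map_id T
    ext x
    exact ψ.apply_symm_apply x

/-- The elements of `H` that act by conjugation on the socle of `H` as elements of the base
group. For a finite semisimple `H` the conjugation action embeds `H` into `Aut(Soc(H))`, and this
subgroup is the intersection of `H` with the base group. -/
def permutationKernel (H : Type*) [Group H] : Subgroup H :=
  (baseGroup (socle H)).comap MulAut.conjNormal

instance permutationKernel_normal (H : Type*) [Group H] : (permutationKernel H).Normal :=
  Subgroup.Normal.comap inferInstance _

/-- The permutation part `P(H)` of `H`. -/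
abbrev PermutationPart (H : Type*) [Group H] : Type _ :=
  H ⧸ permutationKernel H

end SegmentIdentity

/-! Let `D` be a simple direct factor of `Soc(H)`, with normalizer `N`. The conjugates of `D` are
indexed by `H ⧸ N`, and distinct ones commute. After identifying all of them with `D` through coset
representatives, `h ∈ H` acts on the conjugates of `D` by a permutation of `H ⧸ N` together with one
automorphism of `D` for each point of `H ⧸ N`; these automorphisms form a cocycle. Evaluating
`w(g)` letter by letter, starting at the coset `N`, the letter at position `t` contributes the
cocycle value of `g_{x_t}` at the point `I_t(w)(g)⁻¹ N`, so the automorphism of `D` obtained is a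
value of the variation of `w` whose second index at `t` records that point. Multiplying each
`g_x` by elements of the conjugates of `D` changes the automorphisms by arbitrary independent inner
factors without moving the points. Hence `w ≡ 1` on `H` makes this variation a coset identity over
`D`; by hypothesis it is not `(i,j)`-split, so `I_i(w)(g)⁻¹ N = I_j(w)(g)⁻¹ N`. As `D` varies, the
groups `N` intersect in the kernel of `H → P(H)`. -/

namespace SegmentIdentity

section Cocycle

variable {G Ω A : Type*} [Group G] [MulAction G Ω] [Group A]

/-- A cocycle on the `G`-set `Ω` with values in `A`: the condition that
`g ↦ (c g, action of g on Ω)` be a homomorphism into the unrestricted wreath product of `A` with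
the symmetric group on `Ω`. -/
def IsCocycle (c : G → Ω → A) : Prop :=
  ∀ g h ω, c (g * h) ω = c g ω * c h (g⁻¹ • ω)

theorem IsCocycle.map_one {c : G → Ω → A} (hc : IsCocycle c) (ω : Ω) : c 1 ω = 1 := by
  simpa using hc 1 1 ω

theorem IsCocycle.map_inv {c : G → Ω → A} (hc : IsCocycle c) (g : G) (ω : Ω) :
    c g⁻¹ ω = (c g (g • ω))⁻¹ := by
  rw [eq_inv_iff_mul_eq_one, ← hc.map_one ω, ← inv_mul_cancel g, hc, inv_inv]

theorem lift_mk_cons {X : Type*} (g : X → G) (x : X) (b : Bool) (L : List (X × Bool)) :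
    FreeGroup.lift g (FreeGroup.mk ((x, b) :: L)) =
      cond b (g x) (g x)⁻¹ * FreeGroup.lift g (FreeGroup.mk L) := by
  simp [FreeGroup.lift_mk]

/-- The second argument of `c` in `ha` is the point reached by the initial segment at `t`; the
initial segment of an inverse letter includes that letter because `c g⁻¹ ω` is the inverse of the
value of `c g` at `g • ω`. -/
theorem IsCocycle.lift_mk_ofFn {c : G → Ω → A} (hc : IsCocycle c) {X Y : Type*} (g : X → G)
    (a : Y → A) (L : List (X × Bool)) (y : Fin L.length → Y) (ω : Ω)
    (ha : ∀ t, a (y t) = c (g (L.get t).1) ((FreeGroup.lift g (FreeGroup.mk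
      (L.take (if (L.get t).2 then (t : ℕ) else t + 1))))⁻¹ • ω)) :
    FreeGroup.lift a (FreeGroup.mk (List.ofFn fun t => (y t, (L.get t).2))) =
      c (FreeGroup.lift g (FreeGroup.mk L)) ω := by
  induction L generalizing ω with
  | nil => simp [hc.map_one]
  | cons p L ih =>
    obtain ⟨x, b⟩ := p
    have hfirst : cond b (a (y 0)) (a (y 0))⁻¹ = c (cond b (g x) (g x)⁻¹) ω := by
      rw [ha 0]
      cases b <;> simp [hc.map_inv, ← FreeGroup.one_eq_mk]
    have hrest : FreeGroup.lift a
        (FreeGroup.mk (List.ofFn fun t => (y (Fin.succ t), (L.get t).2))) =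
        c (FreeGroup.lift g (FreeGroup.mk L)) ((cond b (g x) (g x)⁻¹)⁻¹ • ω) := by
      refine ih _ _ fun t => (ha t.succ).trans ?_
      have hlen : (if (L.get t).2 then (t : ℕ) + 1 else t + 1 + 1) =
          (if (L.get t).2 then (t : ℕ) else t + 1) + 1 := by split_ifs <;> rfl
      simp only [List.length_cons, List.get_cons_succ', Fin.val_succ, hlen, List.take_succ_cons,
        lift_mk_cons, mul_inv_rev, mul_smul]
    rw [lift_mk_cons, hc, ← hfirst, ← hrest, List.ofFn_succ, lift_mk_cons]
    rfl

theorem lift_smul_eq_lift_smul {X : Type*} {g k : X → G}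
    (h : ∀ x (ω : Ω), k x • ω = g x • ω) (u : FreeGroup X) (ω : Ω) :
    FreeGroup.lift k u • ω = FreeGroup.lift g u • ω := by
  have hcomp : (MulAction.toPermHom G Ω).comp (FreeGroup.lift k) =
      (MulAction.toPermHom G Ω).comp (FreeGroup.lift g) := by
    ext x ω
    simpa using h x ω
  exact congrArg (fun σ : Equiv.Perm Ω => σ ω) (DFunLike.congr_fun hcomp u)

end Cocycle

section Conjugates

variable {H : Type*} [Group H] {D : Subgroup H}

theorem out_inv_mul_mul_out_mem (K : Subgroup H) (h : H) (ω : H ⧸ K) :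
    ω.out⁻¹ * h * (h⁻¹ • ω).out ∈ K := by
  rw [mul_assoc, ← QuotientGroup.eq, QuotientGroup.out_eq', ← smul_eq_mul,
    ← MulAction.Quotient.smul_mk, QuotientGroup.out_eq', smul_inv_smul]

/-- The automorphism of `D` which conjugation by `h`, from the conjugate of `D` at the point
`h⁻¹ • ω` to the one at `ω`, becomes once every conjugate of `D` is identified with `D` through the
chosen coset representatives of the normalizer. -/
noncomputable def conjCocycle (D : Subgroup H) (h : H)
    (ω : H ⧸ Subgroup.normalizer (D : Set H)) : MulAut D :=
  D.normalizerMonoidHom ⟨_, out_inv_mul_mul_out_mem _ h ω⟩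

theorem isCocycle_conjCocycle (D : Subgroup H) : IsCocycle (conjCocycle D) := by
  intro g h ω
  rw [conjCocycle, conjCocycle, conjCocycle, ← map_mul]
  congr 1
  ext
  simp only [mul_inv_rev, mul_smul, Subgroup.coe_mul]
  group

theorem smul_eq_of_mem_normalCore {K : Subgroup H} {h : H} (hh : h ∈ K.normalCore) (ω : H ⧸ K) :
    h • ω = ω := by
  rw [Subgroup.normalCore_eq_ker, MonoidHom.mem_ker] at hh
  exact congrArg (fun σ : Equiv.Perm (H ⧸ K) => σ ω) hh

theorem coe_conjCocycle_apply_of_mem_normalCore {h : H}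
    (hh : h ∈ (Subgroup.normalizer (D : Set H)).normalCore)
    (ω : H ⧸ Subgroup.normalizer (D : Set H)) (y : D) :
    (conjCocycle D h ω y : H) = ω.out⁻¹ * h * ω.out * y * (ω.out⁻¹ * h * ω.out)⁻¹ := by
  change ω.out⁻¹ * h * (h⁻¹ • ω).out * y * (ω.out⁻¹ * h * (h⁻¹ • ω).out)⁻¹ = _
  rw [smul_eq_of_mem_normalCore (inv_mem hh)]

/-- The subgroup `D` commutes elementwise with each of its conjugates other than `D`. -/
def CommutesWithConjugates (D : Subgroup H) : Prop :=
  ∀ h ∉ Subgroup.normalizer (D : Set H), ∀ x ∈ D, ∀ y ∈ D, Commute (h * x * h⁻¹) y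

namespace CommutesWithConjugates

theorem le_normalCore (hD : CommutesWithConjugates D) :
    D ≤ (Subgroup.normalizer (D : Set H)).normalCore := by
  intro x hx h
  by_cases hh : h ∈ Subgroup.normalizer (D : Set H)
  · exact D.le_normalizer ((Subgroup.mem_normalizer_iff.1 hh x).1 hx)
  · exact Subgroup.centralizer_le_normalizer _
      (Subgroup.mem_centralizer_iff.2 fun y hy => (hD h hh x hx y hy).eq.symm)

theorem conj_mem_normalCore (hD : CommutesWithConjugates D) (h : H) (s : D) :
    h * s * h⁻¹ ∈ (Subgroup.normalizer (D : Set H)).normalCore :=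
  (Subgroup.normalCore_normal _).conj_mem _ (hD.le_normalCore s.2) h

open Classical in
theorem conjCocycle_conj_out (hD : CommutesWithConjugates D) (s : D)
    (α ω : H ⧸ Subgroup.normalizer (D : Set H)) :
    conjCocycle D (α.out * s * α.out⁻¹) ω = if ω = α then MulAut.conj s else 1 := by
  ext y
  rw [coe_conjCocycle_apply_of_mem_normalCore (hD.conj_mem_normalCore _ s)]
  split_ifs with hωα
  · subst hωα
    simp [mul_assoc]
  · have hout : ω.out⁻¹ * α.out ∉ Subgroup.normalizer (D : Set H) := by
      rwa [← QuotientGroup.eq, QuotientGroup.out_eq', QuotientGroup.out_eq']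
    have hcomm := (hD _ hout s s.2 y y.2).eq
    rw [mul_inv_eq_iff_eq_mul]
    simpa [mul_assoc] using hcomm

theorem exists_conjCocycle_eq_conj (hD : CommutesWithConjugates D)
    (s : H ⧸ Subgroup.normalizer (D : Set H) → D)
    {P : Set (H ⧸ Subgroup.normalizer (D : Set H))} (hP : P.Finite) :
    ∃ h ∈ (Subgroup.normalizer (D : Set H)).normalCore,
      ∀ ω ∈ P, conjCocycle D h ω = MulAut.conj (s ω) := by
  classical
  suffices h : ∃ h ∈ (Subgroup.normalizer (D : Set H)).normalCore,
      ∀ ω, conjCocycle D h ω = if ω ∈ P then MulAut.conj (s ω) else 1 by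
    obtain ⟨h, hcore, hval⟩ := h
    exact ⟨h, hcore, fun ω hω => by rw [hval, if_pos hω]⟩
  induction P, hP using Set.Finite.induction_on with
  | empty => exact ⟨1, one_mem _, fun ω => by simp [(isCocycle_conjCocycle D).map_one]⟩
  | @insert α P hα _ ih =>
    obtain ⟨h, hcore, hval⟩ := ih
    have hcore' := hD.conj_mem_normalCore α.out (s α)
    refine ⟨α.out * s α * α.out⁻¹ * h, mul_mem hcore' hcore, fun ω => ?_⟩
    rw [isCocycle_conjCocycle D, smul_eq_of_mem_normalCore (inv_mem hcore'),
      hD.conjCocycle_conj_out, hval]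
    by_cases hωα : ω = α
    · simp [hωα, hα]
    · simp [hωα]

theorem isCosetIdentity_variation (hD : CommutesWithConjugates D) {d : ℕ} {w : FreeGroup (Fin d)}
    (hw : SatisfiesIdentity H w) (g : Fin d → H)
    {e : H ⧸ Subgroup.normalizer (D : Set H) → ℕ}
    (he : Set.InjOn e (Set.range fun t => ((FreeGroup.lift g (initSegment w t))⁻¹ : H))) :
    IsCosetIdentity
      (variation w fun t => e ((FreeGroup.lift g (initSegment w t))⁻¹ : H)) D := by
  set ω : Fin w.toWord.length → H ⧸ Subgroup.normalizer (D : Set H) :=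
    fun t => ((FreeGroup.lift g (initSegment w t))⁻¹ : H) with hω
  have hc := isCocycle_conjCocycle D
  refine ⟨fun p => conjCocycle D (g p.1) (Function.invFunOn e (Set.range ω) p.2), 1, fun s => ?_⟩
  choose σ hσ_core hσ using fun x =>
    hD.exists_conjCocycle_eq_conj (fun α => s (x, e α)) (Set.finite_range ω)
  have hsmul : ∀ x (α : H ⧸ Subgroup.normalizer (D : Set H)), (σ x * g x) • α = g x • α :=
    fun x α => by rw [mul_smul, smul_eq_of_mem_normalCore (hσ_core x)]
  have hpoint : ∀ t, (FreeGroup.lift (fun x => σ x * g x) (initSegment w t))⁻¹ •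
      ((1 : H) : H ⧸ Subgroup.normalizer (D : Set H)) = ω t := fun t => by
    rw [← map_inv, lift_smul_eq_lift_smul hsmul, map_inv]
    simp [hω]
  have hletter := hc.lift_mk_ofFn (fun x => σ x * g x)
    (fun p => MulAut.conj (s p) * conjCocycle D (g p.1) (Function.invFunOn e (Set.range ω) p.2))
    w.toWord (fun t => (letterVar w t, e (ω t))) (1 : H) fun t => by
      refine Eq.trans ?_ (congrArg _ (hpoint t)).symm
      rw [hc, smul_eq_of_mem_normalCore (inv_mem (hσ_core _)), hσ _ _ (Set.mem_range_self t),
        he.leftInvOn_invFunOn (Set.mem_range_self t)]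
      rfl
  rw [FreeGroup.mk_toWord, hw, hc.map_one] at hletter
  exact hletter

end CommutesWithConjugates

end Conjugates

theorem IsCosetIdentity.of_mulEquiv {X S S' : Type*} [Group S] [Group S'] {w : FreeGroup X}
    (h : IsCosetIdentity w S) (φ : S ≃* S') : IsCosetIdentity w S' := by
  obtain ⟨α, β, hβ⟩ := h
  refine ⟨fun x => MulAut.congr φ (α x), MulAut.congr φ β, fun s => ?_⟩
  rw [← hβ fun x => φ.symm (s x), ← MulEquiv.coe_toMonoidHom, ← MonoidHom.comp_apply]
  congr 1
  ext x y
  simp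

theorem IsWMB.not_isCosetIdentity {X : Type*} {w : FreeGroup X} (hw : IsWMB w) (S : Type*)
    [Group S] [Finite S] [IsSimpleGroup S] (hS : ∃ a b : S, a * b ≠ b * a) :
    ¬ IsCosetIdentity w S := by
  intro h
  let φ : Shrink.{0} S ≃* S := Shrink.mulEquiv
  have : Finite (Shrink.{0} S) := Finite.of_equiv S φ.symm.toEquiv
  have : IsSimpleGroup (Shrink.{0} S) := φ.isSimpleGroup
  obtain ⟨a, b, hab⟩ := hS
  refine hw (Shrink.{0} S) ⟨φ.symm a, φ.symm b, fun hcomm => hab ?_⟩ (h.of_mulEquiv φ.symm)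
  simpa [← map_mul] using hcomm

section Socle

namespace IsMinimalNormal

variable {G : Type*} [Group G] {T T' : Subgroup G}

theorem le_of_inf_ne_bot (hT : IsMinimalNormal T) {K : Subgroup G} [K.Normal]
    (h : T ⊓ K ≠ ⊥) : T ≤ K :=
  have := hT.prop.1
  (hT.le_of_le ⟨inferInstance, h⟩ inf_le_left).trans inf_le_right

theorem le_centralizer_of_not_le (hT : IsMinimalNormal T) {K : Subgroup G} [K.Normal]
    (h : ¬ T ≤ K) : K ≤ Subgroup.centralizer T := by
  have hdisj : Disjoint T K := disjoint_iff.2 (not_imp_comm.1 hT.le_of_inf_ne_bot h)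
  exact fun x hx => Subgroup.mem_centralizer_iff.2 fun y hy =>
    Subgroup.commute_of_normal_of_disjoint _ _ hT.prop.1 ‹_› hdisj y x hy hx

theorem le_centralizer_of_ne (hT : IsMinimalNormal T) (hT' : IsMinimalNormal T')
    (h : T' ≠ T) : T' ≤ Subgroup.centralizer T :=
  have := hT'.prop.1
  hT.le_centralizer_of_not_le fun hle =>
    h (le_antisymm (hT'.le_of_le hT.prop hle) hle)

theorem isSimpleGroup_of_sup_centralizer_eq_top (hT : IsMinimalNormal T)
    (htop : T ⊔ Subgroup.centralizer T = ⊤) : IsSimpleGroup T := by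
  have : Nontrivial T := (Subgroup.nontrivial_iff_ne_bot T).2 hT.prop.2
  refine ⟨fun K hK => or_iff_not_imp_left.2 fun hK_ne => ?_⟩
  have hKT : K.map T.subtype ≤ T := Subgroup.map_subtype_le K
  have hnormal : (K.map T.subtype).Normal := by
    rw [← Subgroup.normalizer_eq_top_iff, eq_top_iff, ← htop]
    refine sup_le (Subgroup.le_normalizer_iff.2 ?_)
      ((Subgroup.centralizer_le hKT).trans (Subgroup.centralizer_le_normalizer _))
    rintro t ht _ ⟨k, hk, rfl⟩
    exact ⟨_, hK.conj_mem k hk ⟨t, ht⟩, rfl⟩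
  have hne : K.map T.subtype ≠ ⊥ := fun h =>
    hK_ne ((Subgroup.map_eq_bot_iff_of_injective _ T.subtype_injective).1 h)
  rw [eq_top_iff, ← Subgroup.map_subtype_le_map_subtype, ← MonoidHom.range_eq_map,
    Subgroup.range_subtype]
  exact hT.le_of_le ⟨hnormal, hne⟩ hKT

end IsMinimalNormal

variable {H : Type*} [Group H] {T : Subgroup (socle H)}

namespace IsMinimalNormal

theorem sup_centralizer_eq_top (hT : IsMinimalNormal T) :
    T ⊔ Subgroup.centralizer (T : Set (socle H)) = ⊤ := by
  suffices h : socle H ≤ (T ⊔ Subgroup.centralizer (T : Set (socle H))).map (socle H).subtype by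
    rwa [eq_top_iff, ← Subgroup.map_subtype_le_map_subtype, ← MonoidHom.range_eq_map,
      Subgroup.range_subtype]
  refine sSup_le fun M (hM : IsMinimalNormal M) => ?_
  have hMsoc : M ≤ socle H := le_sSup hM
  have := hM.prop.1
  by_cases hTM : T ≤ M.subgroupOf (socle H)
  · -- By minimality `M` is the normal closure of `T`, and every conjugate of `T` is again minimal
    -- normal in the socle.
    have hle : Subgroup.normalClosure (T.map (socle H).subtype : Set H) ≤ M :=
      Subgroup.normalClosure_le_normal (Subgroup.map_le_iff_le_comap.2 hTM)
    have hne : Subgroup.normalClosure (T.map (socle H).subtype : Set H) ≠ ⊥ := fun h =>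
      hT.prop.2 ((Subgroup.map_eq_bot_iff_of_injective _ (socle H).subtype_injective).1
        (le_bot_iff.1 (h ▸ Subgroup.le_normalClosure)))
    refine (hM.le_of_le ⟨inferInstance, hne⟩ hle).trans ((Subgroup.closure_le _).2 fun x hx => ?_)
    obtain ⟨_, ⟨t, ht, rfl⟩, htx⟩ := Group.mem_conjugatesOfSet_iff.1 hx
    obtain ⟨h, rfl⟩ := isConj_iff.1 htx
    refine ⟨MulAut.conjNormal h t, ?_, rfl⟩
    have hmem : MulAut.conjNormal h t ∈
        T.map (MulAut.conjNormal h : MulAut (socle H)).toMonoidHom :=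
      ⟨t, ht, rfl⟩
    by_cases hconj : T.map (MulAut.conjNormal h : MulAut (socle H)).toMonoidHom = T
    · exact le_sup_left (a := T) (hconj ▸ hmem)
    · exact le_sup_right (a := T)
        (hT.le_centralizer_of_ne (hT.map_mulEquiv _) hconj hmem)
  · rw [← Subgroup.map_subgroupOf_eq_of_le hMsoc]
    exact Subgroup.map_mono
      ((hT.le_centralizer_of_not_le hTM).trans le_sup_right)

theorem isSimpleGroup (hT : IsMinimalNormal T) : IsSimpleGroup T :=
  hT.isSimpleGroup_of_sup_centralizer_eq_top hT.sup_centralizer_eq_top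

end IsMinimalNormal

theorem IsSemisimple.center_socle (hH : IsSemisimple H) : Subgroup.center (socle H) = ⊥ := by
  rw [← Subgroup.map_eq_bot_iff_of_injective _ (socle H).subtype_injective]
  refine hH _ inferInstance (Group.isSolvable_of_comm ?_)
  rintro ⟨_, x, hx, rfl⟩ ⟨_, y, -, rfl⟩
  exact Subtype.ext (congrArg (socle H).subtype (Subgroup.mem_center_iff.1 hx y).symm)

theorem IsSemisimple.exists_mul_ne_mul (hH : IsSemisimple H) (hT : IsMinimalNormal T) :
    ∃ a b : T, a * b ≠ b * a := by
  by_contra! hcomm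
  have hself : T ≤ Subgroup.centralizer T := fun x hx =>
    Subgroup.mem_centralizer_iff.2 fun y hy => congrArg Subtype.val (hcomm ⟨y, hy⟩ ⟨x, hx⟩)
  have hcentral : T ≤ Subgroup.center (socle H) := by
    rw [← SetLike.coe_subset_coe, ← Subgroup.centralizer_eq_top_iff_subset,
      ← hT.sup_centralizer_eq_top, sup_eq_right.2 hself]
  exact hT.prop.2 (le_bot_iff.1 (hH.center_socle ▸ hcentral))

theorem map_conjNormal_eq_iff {N : Subgroup H} [N.Normal] (K : Subgroup N) (h : H) :
    K.map (MulAut.conjNormal h : MulAut N).toMonoidHom = K ↔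
      h ∈ Subgroup.normalizer (K.map N.subtype : Set H) := by
  have hmap : (K.map (MulAut.conjNormal h : MulAut N).toMonoidHom).map N.subtype =
      (K.map N.subtype).map (MulAut.conj h).toMonoidHom := by
    rw [Subgroup.map_map, Subgroup.map_map]
    rfl
  rw [← (Subgroup.map_injective N.subtype_injective).eq_iff, hmap]
  exact Subgroup.mem_normalizer_iff_map_conj_eq.symm

theorem mem_permutationKernel_iff {h : H} :
    h ∈ permutationKernel H ↔ ∀ T : Subgroup (socle H), IsMinimalNormal T →
      h ∈ Subgroup.normalizer (T.map (socle H).subtype : Set H) :=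
  forall₂_congr fun T _ => map_conjNormal_eq_iff T h

theorem IsMinimalNormal.commutesWithConjugates (hT : IsMinimalNormal T) :
    CommutesWithConjugates (T.map (socle H).subtype) := by
  rintro h hh _ ⟨x, hx, rfl⟩ _ ⟨y, hy, rfl⟩
  rw [← map_conjNormal_eq_iff] at hh
  have hcomm := Subgroup.mem_centralizer_iff.1
    (hT.le_centralizer_of_ne (hT.map_mulEquiv _) hh ⟨x, hx, rfl⟩) y hy
  exact congrArg (socle H).subtype hcomm.symm

theorem initSegment_mul_inv_mem_normalizer (hH : IsSemisimple H) {d : ℕ} {w : FreeGroup (Fin d)}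
    {i j : Fin w.toWord.length} (hx : letterVar w i = letterVar w j)
    (hwmb : ∀ w', IsSplitVariation w i j w' → IsWMB w') (hw : SatisfiesIdentity H w)
    (g : Fin d → H) (hT : IsMinimalNormal T) [Finite T] :
    FreeGroup.lift g (initSegment w i) * (FreeGroup.lift g (initSegment w j))⁻¹ ∈
      Subgroup.normalizer (T.map (socle H).subtype : Set H) := by
  set D := T.map (socle H).subtype
  let ω : Fin w.toWord.length → H ⧸ Subgroup.normalizer (D : Set H) :=
    fun t => ((FreeGroup.lift g (initSegment w t))⁻¹ : H)
  suffices h : ω i = ω j by simpa [ω, QuotientGroup.eq] using h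
  obtain ⟨e, he⟩ := Set.countable_iff_exists_injOn.1 (Set.finite_range ω).countable
  by_contra hne
  have hsplit : IsSplitVariation w i j (variation w (e ∘ ω)) :=
    ⟨_, rfl, hx, fun h => hne (he ⟨i, rfl⟩ ⟨j, rfl⟩ (Prod.ext_iff.1 h).2)⟩
  have := hT.isSimpleGroup
  have φ : T ≃* D := T.equivMapOfInjective _ (socle H).subtype_injective
  exact (hwmb _ hsplit).not_isCosetIdentity T (hH.exists_mul_ne_mul hT)
    ((hT.commutesWithConjugates.isCosetIdentity_variation hw g he).of_mulEquiv φ.symm)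

theorem satisfiesIdentity_segment (hH : IsSemisimple H)
    (hfin : ∀ T : Subgroup (socle H), IsMinimalNormal T → Finite T) {d : ℕ}
    {w : FreeGroup (Fin d)} {i j : Fin w.toWord.length} (hx : letterVar w i = letterVar w j)
    (hwmb : ∀ w', IsSplitVariation w i j w' → IsWMB w') (hw : SatisfiesIdentity H w) :
    SatisfiesIdentity (PermutationPart H) (segment w i j) := by
  intro q
  obtain ⟨g, rfl⟩ : ∃ g : Fin d → H, QuotientGroup.mk' (permutationKernel H) ∘ g = q :=
    (QuotientGroup.mk'_surjective _).comp_left q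
  have hkernel : FreeGroup.lift g (initSegment w i) * (FreeGroup.lift g (initSegment w j))⁻¹ ∈
      permutationKernel H := mem_permutationKernel_iff.2 fun T hT =>
    have := hfin T hT
    initSegment_mul_inv_mem_normalizer hH hx hwmb hw g hT
  have hlift : FreeGroup.lift (QuotientGroup.mk' (permutationKernel H) ∘ g) =
      (QuotientGroup.mk' (permutationKernel H)).comp (FreeGroup.lift g) := by
    ext x
    simp
  rw [hlift, MonoidHom.comp_apply, QuotientGroup.mk'_apply, QuotientGroup.eq_one_iff, ← inv_mem_iff,
    segment, map_mul, map_inv, mul_inv_rev, inv_inv]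
  exact (permutationKernel_normal H).mem_comm hkernel

end Socle

section ShorterIdentity

variable {d : ℕ} {w : FreeGroup (Fin d)} {i j : Fin w.toWord.length}

theorem length_toWord_initSegment (w : FreeGroup (Fin d)) (t : Fin w.toWord.length) :
    (initSegment w t).toWord.length = if letterSign w t then (t : ℕ) else t + 1 := by
  rw [initSegment, FreeGroup.toWord_mk,
    (FreeGroup.isReduced_toWord.infix (List.take_prefix _ _).isInfix).reduce_eq,
    List.length_take, min_eq_left]
  split_ifs <;> omega

theorem letterSign_eq_of_succ_eq (hij : (i : ℕ) + 1 = j) (hx : letterVar w i = letterVar w j) :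
    letterSign w i = letterSign w j := by
  have hchain := List.isChain_iff_getElem.1 (FreeGroup.isReduced_toWord (x := w)) i (by omega)
  simp only [hij] at hchain
  exact hchain hx

theorem segment_ne_one (hij : i < j) (hx : letterVar w i = letterVar w j) :
    segment w i j ≠ 1 := by
  intro h
  have hlength := length_toWord_initSegment w i
  rw [inv_mul_eq_one.1 h, length_toWord_initSegment] at hlength
  have hsucc := letterSign_eq_of_succ_eq (i := i) (j := j)
  grind

/-- The subword of `w` strictly between the positions `i` and `j`. -/
def innerWord (w : FreeGroup (Fin d)) (i j : Fin w.toWord.length) : FreeGroup (Fin d) :=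
  FreeGroup.mk ((w.toWord.take j).drop (i + 1))

theorem length_toWord_innerWord_le (w : FreeGroup (Fin d)) (i j : Fin w.toWord.length) :
    (innerWord w i j).toWord.length ≤ j - (i + 1) :=
  FreeGroup.norm_mk_le.trans (by simp)

theorem mk_take_succ (w : FreeGroup (Fin d)) (t : Fin w.toWord.length) :
    FreeGroup.mk (w.toWord.take (t + 1)) =
      FreeGroup.mk (w.toWord.take t) * FreeGroup.mk [(letterVar w t, letterSign w t)] := by
  rw [List.take_succ_eq_append_getElem t.2, ← FreeGroup.mul_mk]
  rfl

theorem segment_eq_mul_innerWord_mul (hij : i < j) :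
    segment w i j = (if letterSign w i then FreeGroup.of (letterVar w i) else 1) *
      innerWord w i j * (if letterSign w j then 1 else (FreeGroup.of (letterVar w j))⁻¹) := by
  have hi : FreeGroup.mk (w.toWord.take (i + 1)) =
      initSegment w i * if letterSign w i then FreeGroup.of (letterVar w i) else 1 := by
    cases h : letterSign w i
    · simp [initSegment, h]
    · rw [mk_take_succ, h]
      simp [initSegment, h, FreeGroup.of]
  have hj : initSegment w j = FreeGroup.mk (w.toWord.take j) *
      if letterSign w j then 1 else (FreeGroup.of (letterVar w j))⁻¹ := by
    cases h : letterSign w j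
    · simp only [initSegment, h, Bool.false_eq_true, if_false]
      rw [mk_take_succ, h]
      rfl
    · simp [initSegment, h]
  have hinner : FreeGroup.mk (w.toWord.take (i + 1)) * innerWord w i j =
      FreeGroup.mk (w.toWord.take j) := by
    rw [innerWord, FreeGroup.mul_mk]
    conv_rhs => rw [← List.take_append_drop (i + 1) (w.toWord.take j), List.take_take,
      min_eq_left (by omega)]
  rw [segment, hj, ← hinner, hi]
  group

theorem SatisfiesIdentity.of_conj {X G : Type*} [Group G] {u v : FreeGroup X}
    (h : SatisfiesIdentity G (u * v * u⁻¹)) : SatisfiesIdentity G v := fun g => by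
  simpa using h g

theorem length_toWord_segment_le (hij : i < j)
    (hsign : ¬ (letterSign w i = true ∧ letterSign w j = false)) :
    (segment w i j).toWord.length ≤ j - i := by
  have hinner : (innerWord w i j).norm ≤ j - (i + 1) := length_toWord_innerWord_le w i j
  change (segment w i j).norm ≤ _
  rw [segment_eq_mul_innerWord_mul hij]
  cases hi : letterSign w i <;> cases hj : letterSign w j
  · have := (innerWord w i j).norm_mul_le (FreeGroup.of (letterVar w j))⁻¹
    rw [FreeGroup.norm_inv_eq, FreeGroup.norm_of] at this
    simp only [Bool.false_eq_true, if_false, one_mul]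
    omega
  · simp only [Bool.false_eq_true, if_false, if_true, one_mul, mul_one]
    omega
  · exact absurd ⟨hi, hj⟩ hsign
  · have := (FreeGroup.of (letterVar w i)).norm_mul_le (innerWord w i j)
    rw [FreeGroup.norm_of] at this
    simp only [if_true, mul_one]
    omega

theorem exists_shorter_of_satisfiesIdentity_segment {G : Type*} [Group G] (hij : i < j)
    (hx : letterVar w i = letterVar w j) (h : SatisfiesIdentity G (segment w i j)) :
    ∃ v : FreeGroup (Fin d), v ≠ 1 ∧ v.toWord.length < w.toWord.length ∧
      SatisfiesIdentity G v := by
  have hne := segment_ne_one hij hx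
  by_cases hsign : letterSign w i = true ∧ letterSign w j = false
  · have hconj : segment w i j = FreeGroup.of (letterVar w i) * innerWord w i j *
        (FreeGroup.of (letterVar w i))⁻¹ := by
      rw [segment_eq_mul_innerWord_mul hij, hsign.1, hsign.2, hx]
      rfl
    rw [hconj] at h hne
    have := length_toWord_innerWord_le w i j
    exact ⟨innerWord w i j, fun h1 => hne (by simp [h1]), by omega, h.of_conj⟩
  · have := length_toWord_segment_le hij hsign
    exact ⟨segment w i j, hne, by omega, h⟩

end ShorterIdentity

end SegmentIdentity

theorem theorem5p4_general {d : ℕ} (w : FreeGroup (Fin d)) (i j : Fin w.toWord.length) (hij : i < j)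
    (hx : SegmentIdentity.letterVar w i = SegmentIdentity.letterVar w j)
    (hwmb : ∀ w' : FreeGroup (Fin d × ℕ),
      SegmentIdentity.IsSplitVariation w i j w' → SegmentIdentity.IsWMB w')
    (H : Type*) [Group H] (hH : SegmentIdentity.IsSemisimple H)
    (hfin : ∀ T : Subgroup (SegmentIdentity.socle H),
      SegmentIdentity.IsMinimalNormal T → Finite T)
    (hw : SegmentIdentity.SatisfiesIdentity H w) :
    SegmentIdentity.SatisfiesIdentity (SegmentIdentity.PermutationPart H)
        (SegmentIdentity.segment w i j) ∧
      ∃ v : FreeGroup (Fin d), v ≠ 1 ∧ v.toWord.length < w.toWord.length ∧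
        SegmentIdentity.SatisfiesIdentity (SegmentIdentity.PermutationPart H) v :=
  have h := SegmentIdentity.satisfiesIdentity_segment hH hfin hx hwmb hw
  ⟨h, SegmentIdentity.exists_shorter_of_satisfiesIdentity_segment hij hx h⟩

theorem theorem5p4 {d : ℕ} (w : FreeGroup (Fin d)) (i j : Fin w.toWord.length) (hij : i < j)
    (hx : SegmentIdentity.letterVar w i = SegmentIdentity.letterVar w j)
    (hwmb : ∀ w' : FreeGroup (Fin d × ℕ),
      SegmentIdentity.IsSplitVariation w i j w' → SegmentIdentity.IsWMB w')
    (H : Type*) [Group H] [Finite H] (hH : SegmentIdentity.IsSemisimple H)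
    (hw : SegmentIdentity.SatisfiesIdentity H w) :
    SegmentIdentity.SatisfiesIdentity (SegmentIdentity.PermutationPart H)
        (SegmentIdentity.segment w i j) ∧
      ∃ v : FreeGroup (Fin d), v ≠ 1 ∧ v.toWord.length < w.toWord.length ∧
        SegmentIdentity.SatisfiesIdentity (SegmentIdentity.PermutationPart H) v :=
  theorem5p4_general w i j hij hx hwmb H hH (fun _ _ => inferInstance) hw
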